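/- Let $M$ be an $n$-dimensional $C^\infty$ manifold, $g$ a smooth Riemannian metric on $M$ with fundamental function $L(x,y)=\sqrt{g_x(y,y)}$, $\beta(x,y)=b_i(x)y^i$ a smooth one-form on $M$ which is Riemann-parallel, i.e. $\partial_j b_i-\gamma^r_{ij}b_r=0$ in all local coordinates, where $\gamma^r_{ij}$ are the Christoffel symbols of $g$, and $\sigma$ a smooth function on $M$ which is homothetic, i.e. $\partial_i\sigma=0$ (so $\sigma$ is locally constant). Let $f$ be a smooth, positively homogeneous function of degree one of two real variables, defined on an open set $U\subseteq\mathbb R^2$ with $cU\subseteq U$ for all $c>0$, and consider the generalized $\beta$-conformal change $$\overline L(x,y)=f\bigl(e^{\sigma(x)}L(x,y),\beta(x,y)\bigr).$$ Let $A$ be an open set of nonzero tangent vectors of $M$ (for instance all of them), stable under multiplication by positive reals, such that $(e^{\sigma}L,\beta)$ maps $A$ into $U$, and assume that $\overline L$ is a Finsler structure on $A$: it is smooth, positive and positively homogeneous of degree one in $y$ on $A$, and its metric tensor $\overline g_{ij}=\frac12\frac{\partial^2\overline L^2}{\partial y^i\partial y^j}$ is nondegenerate on $A$. Then $\overline F^n=(M,\overline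 L)$ is a Berwald space: in all local coordinates the coefficients $\overline G^i_{jk}=\frac{\partial^2\overline G^i}{\partial y^j\partial y^k}$ of its Berwald connection on $A$ are functions of the position $x$ only. Here $\overline G^i=\frac12\overline\gamma^i_{jk}y^jy^k$ with $\overline\gamma^i_{jk}=\frac12\overline g^{ir}(\partial_j\overline g_{kr}+\partial_k\overline g_{jr}-\partial_r\overline g_{jk})$, where $\partial_i=\partial/\partial x^i$ and $(\overline g^{ij})$ is the inverse matrix of $(\overline g_{ij})$. -/

import Mathlib

open scoped Manifold ContDiff

noncomputable section

namespace Finsler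

/-- The model space `ℝⁿ`. -/
abbrev Model (n : ℕ) : Type := EuclideanSpace ℝ (Fin n)

/-- The `i`-th coordinate vector of `ℝⁿ`. -/
def stdVec {n : ℕ} (i : Fin n) : Model n := EuclideanSpace.single i 1

/-- The partial derivative `∂ᵢ u` of a function on `ℝⁿ`. -/
def pd {n : ℕ} (i : Fin n) (u : Model n → ℝ) (x : Model n) : ℝ :=
  fderiv ℝ u x (stdVec i)

/-! ### Objects in local coordinates

A function on (an open part of) the tangent bundle is, in the coordinates `(xⁱ, yⁱ)` induced by a
chart, a function `F : ℝⁿ → ℝⁿ → ℝ`, `(x, y) ↦ F x y`. -/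

/-- The Christoffel symbols `γⁱⱼₖ = ½ aⁱʳ (∂ⱼ aₖᵣ + ∂ₖ aⱼᵣ - ∂ᵣ aⱼₖ)` of a symmetric matrix
valued function `a` of `x`; here `(aⁱʳ)` is the inverse matrix. -/
def christoffel {n : ℕ} (a : Model n → Matrix (Fin n) (Fin n) ℝ) (x : Model n)
    (i j k : Fin n) : ℝ :=
  (1 / 2 : ℝ) * ∑ r, (a x)⁻¹ i r *
    (pd j (fun z => a z k r) x + pd k (fun z => a z j r) x - pd r (fun z => a z j k) x)

/-- The Finsler metric tensor `gᵢⱼ = ½ ∂²(F²)/∂yⁱ∂yʲ`. -/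
def metricTensor {n : ℕ} (F : Model n → Model n → ℝ) (x y : Model n) :
    Matrix (Fin n) (Fin n) ℝ :=
  Matrix.of fun i j => (1 / 2 : ℝ) * pd i (fun v => pd j (fun w => F x w ^ 2) v) y

/-- The coefficients `Gⁱ = ½ γⁱⱼₖ yʲ yᵏ` of the canonical spray, `γⁱⱼₖ(x, y)` being the Christoffel
symbols of `gᵢⱼ(x, y)` with respect to the variables `x`. -/
def sprayCoeff {n : ℕ} (F : Model n → Model n → ℝ) (x y : Model n) (i : Fin n) : ℝ :=
  (1 / 2 : ℝ) * ∑ j, ∑ k, christoffel (fun z => metricTensor F z y) x i j k * y j * y k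

/-- The coefficients `Nⁱⱼ = ∂Gⁱ/∂yʲ` of the Barthel (Cartan nonlinear) connection. -/
def barthelCoeff {n : ℕ} (F : Model n → Model n → ℝ) (x y : Model n) (i j : Fin n) : ℝ :=
  pd j (fun v => sprayCoeff F x v i) y

/-- The coefficients `Gⁱⱼₖ = ∂Nⁱⱼ/∂yᵏ` of the Berwald connection. -/
def berwaldCoeff {n : ℕ} (F : Model n → Model n → ℝ) (x y : Model n) (i j k : Fin n) : ℝ :=
  pd k (fun v => barthelCoeff F x v i j) y

/-! ### Objects on a manifold -/

variable {n : ℕ} {M : Type*} [TopologicalSpace M] [ChartedSpace (Model n) M]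

/-- The tangent vector of `M` which, in the chart `φ`, sits at the point of coordinates `x` and has
components `y`. -/
def tangentPoint (φ : OpenPartialHomeomorph M (Model n)) (x y : Model n) :
    TangentBundle (𝓡 n) M :=
  ⟨φ.symm x, mfderiv (𝓡 n) (𝓡 n) φ.symm x y⟩

/-- The expression of a function on the tangent bundle in the coordinates induced by `φ`. -/
def localRep (φ : OpenPartialHomeomorph M (Model n)) (F : TangentBundle (𝓡 n) M → ℝ) :
    Model n → Model n → ℝ :=
  fun x y => F (tangentPoint φ x y)

/-- `F` is a Finsler structure on the open conic set `A` of nonzero tangent vectors of `M`: it is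
smooth, positive and positively homogeneous of degree one on `A`, and its metric tensor is
nondegenerate on `A`. If `A` is the set of all nonzero tangent vectors, this is a Finsler structure
in the usual sense; smaller sets `A` serve metrics such as Kropina's. -/
structure IsFinslerStructureOn [IsManifold (𝓡 n) ∞ M] (A : Set (TangentBundle (𝓡 n) M))
    (F : TangentBundle (𝓡 n) M → ℝ) : Prop where
  isOpen : IsOpen A
  ne_zero : ∀ v ∈ A, v.2 ≠ 0
  conic : ∀ v ∈ A, ∀ c : ℝ, 0 < c → (⟨v.1, c • v.2⟩ : TangentBundle (𝓡 n) M) ∈ A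
  smooth : ContMDiffOn (𝓡 n).tangent 𝓘(ℝ) ∞ F A
  pos : ∀ v ∈ A, 0 < F v
  homogeneous : ∀ v ∈ A, ∀ c : ℝ, 0 < c →
    F (⟨v.1, c • v.2⟩ : TangentBundle (𝓡 n) M) = c * F v
  nondegenerate : ∀ φ ∈ IsManifold.maximalAtlas (𝓡 n) ∞ M, ∀ x ∈ φ.target, ∀ y : Model n,
    tangentPoint φ x y ∈ A → (metricTensor (localRep φ F) x y).det ≠ 0

/-- `(M, F)` is a Berwald space, `F` being defined on `A`: `F` is a Finsler structure on `A`, and in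
all local coordinates of `M` the coefficients `Gⁱⱼₖ(x, y)` of its Berwald connection are functions
of the position `x` only. -/
def IsBerwaldSpaceOn [IsManifold (𝓡 n) ∞ M] (A : Set (TangentBundle (𝓡 n) M))
    (F : TangentBundle (𝓡 n) M → ℝ) : Prop :=
  IsFinslerStructureOn A F ∧
  ∀ φ ∈ IsManifold.maximalAtlas (𝓡 n) ∞ M,
    ∃ Γ : Model n → Fin n → Fin n → Fin n → ℝ,
      ∀ x ∈ φ.target, ∀ y : Model n, tangentPoint φ x y ∈ A →
        ∀ i j k, berwaldCoeff (localRep φ F) x y i j k = Γ x i j k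

/-- A smooth Riemannian metric on `M`. -/
abbrev RiemMetric (n : ℕ) (M : Type*) [TopologicalSpace M] [ChartedSpace (Model n) M]
    [IsManifold (𝓡 n) ∞ M] : Type _ :=
  Bundle.ContMDiffRiemannianMetric (𝓡 n) ∞ (Model n) (fun x : M => TangentSpace (𝓡 n) x)

/-- A covector field on `M`, that is, a (not necessarily smooth) one-form. -/
abbrev CovectorField (n : ℕ) (M : Type*) [TopologicalSpace M] [ChartedSpace (Model n) M] : Type _ :=
  ∀ x : M, TangentSpace (𝓡 n) x →L[ℝ] ℝ

/-- Smoothness of a one-form, as a section of the cotangent bundle. -/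
def IsSmoothOneForm [IsManifold (𝓡 n) ∞ M] (b : CovectorField n M) : Prop :=
  ContMDiff (𝓡 n) ((𝓡 n).prod 𝓘(ℝ, Model n →L[ℝ] ℝ)) ∞
    (fun x : M => Bundle.TotalSpace.mk' (Model n →L[ℝ] ℝ)
      (E := fun x : M => TangentSpace (𝓡 n) x →L[ℝ] ℝ) x (b x))

/-- The function `β(x, y) = bᵢ(x) yⁱ` on the tangent bundle. -/
def oneFormFun (b : CovectorField n M) (v : TangentBundle (𝓡 n) M) : ℝ := b v.1 v.2

/-- The component `bᵢ` of a one-form in the chart `φ`. -/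
def oneFormCoord (φ : OpenPartialHomeomorph M (Model n)) (b : CovectorField n M)
    (i : Fin n) (x : Model n) : ℝ :=
  oneFormFun b (tangentPoint φ x (stdVec i))

section Riemannian

variable [IsManifold (𝓡 n) ∞ M]

/-- The Riemannian fundamental function `L(x, y) = √(gₓ(y, y))`. -/
def riemannianNorm (g : RiemMetric n M) (v : TangentBundle (𝓡 n) M) : ℝ :=
  Real.sqrt (g.inner v.1 v.2 v.2)

/-- The components `aᵢⱼ` of a Riemannian metric in the chart `φ`. -/
def riemCoord (φ : OpenPartialHomeomorph M (Model n)) (g : RiemMetric n M) (x : Model n) :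
    Matrix (Fin n) (Fin n) ℝ :=
  Matrix.of fun i j =>
    g.inner (φ.symm x) (tangentPoint φ x (stdVec i)).2 (tangentPoint φ x (stdVec j)).2

/-- The one-form `b` is parallel for the Levi-Civita connection of `g`:
`∂ⱼ bᵢ - γʳᵢⱼ bᵣ = 0` in all local coordinates. -/
def IsRiemannParallel (g : RiemMetric n M) (b : CovectorField n M) : Prop :=
  ∀ φ ∈ IsManifold.maximalAtlas (𝓡 n) ∞ M, ∀ x ∈ φ.target, ∀ i j : Fin n,
    pd j (oneFormCoord φ b i) x
      - ∑ r, christoffel (riemCoord φ g) x r i j * oneFormCoord φ b r x = 0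

end Riemannian

/-- `σ` is homothetic: it is a smooth function with `∂ᵢ σ = 0`. -/
def IsHomothetic (σ : M → ℝ) : Prop :=
  ContMDiff (𝓡 n) 𝓘(ℝ) ∞ σ ∧ ∀ x : M, mfderiv (𝓡 n) 𝓘(ℝ) σ x = 0

/-- `f` is a smooth, positively homogeneous function of degree one of two real variables, defined on
the open conic set `U`. -/
structure IsHomogeneousChange (U : Set (ℝ × ℝ)) (f : ℝ × ℝ → ℝ) : Prop where
  isOpen : IsOpen U
  conic : ∀ p ∈ U, ∀ c : ℝ, 0 < c → c • p ∈ U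
  smooth : ContDiffOn ℝ ∞ f U
  homogeneous : ∀ p ∈ U, ∀ c : ℝ, 0 < c → f (c • p) = c * f p

/-- The pair `(e^{σ(x)} L(x, y), β(x, y))`. -/
def changeArg (σ : M → ℝ) (L : TangentBundle (𝓡 n) M → ℝ) (b : CovectorField n M)
    (v : TangentBundle (𝓡 n) M) : ℝ × ℝ :=
  (Real.exp (σ v.1) * L v, oneFormFun b v)

/-- The generalized `β`-conformal change `L̄(x, y) = f(e^{σ(x)} L(x, y), β(x, y))` of `L`. -/
def betaConformalChange (f : ℝ × ℝ → ℝ) (σ : M → ℝ) (L : TangentBundle (𝓡 n) M → ℝ)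
    (b : CovectorField n M) (v : TangentBundle (𝓡 n) M) : ℝ :=
  f (changeArg σ L b v)

end Finsler

end

/-! Let `Γ` be the Levi-Civita connection of `g`, and let `δₖ = ∂ₖ - yʲ Γⁱₖⱼ ∂/∂yⁱ` be the
horizontal lift of the `k`-th coordinate field. It kills `aᵢⱼ yⁱ yʲ` because a metric is parallel
for its own connection (`fderiv_quadForm_horizontalLift`), it kills `β` because `b` is parallel
(`fderiv_linForm_horizontalLift`), and it kills `σ` because `dσ = 0`. By the chain rule it kills any
smooth function of `e^σ L` and `β`, hence `L̄` and `L̄²` (`energy_horizontal`).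

Horizontal constancy of the energy determines the spray. For `F` homogeneous of degree one, Euler's
relations reduce the spray to `Gⁱ = ¼ gⁱʳ (yʲ ∂ⱼ ∂F²/∂yʳ - ∂ᵣ F²)` (`sprayCoeff_eq_energy`).
Differentiating `δₖ F² = 0` along `yʳ` and contracting with `yᵏ` evaluates the bracket: it is `2
Γˡⱼₖ yʲ yᵏ gₗᵣ`, so `Gⁱ = ½ Γⁱⱼₖ yʲ yᵏ` (`sprayCoeff_eq_of_horizontal`). Two fibre derivatives then
give `Gⁱⱼₖ = Γⁱⱼₖ` (`berwaldCoeff_eq_of_horizontal`). The Berwald connection of `L̄` is thus the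
Levi-Civita connection of `g`, whose coefficients depend on `x` only. -/

noncomputable section

namespace Finsler

/-! ### Calculus on `ℝⁿ × ℝⁿ`: directional derivatives along base and fibre. -/

section Coordinates

variable {n : ℕ}

/-- The coordinate directions in the base of `ℝⁿ × ℝⁿ`. -/
def baseDir (i : Fin n) : Model n × Model n := (stdVec i, 0)

/-- The coordinate directions in the fibre of `ℝⁿ × ℝⁿ`. -/
def fibreDir (i : Fin n) : Model n × Model n := (0, stdVec i)

/-- The derivative of a real function in a fixed direction, as a function of the point. -/
def dirDeriv {V : Type*} [NormedAddCommGroup V] [NormedSpace ℝ V] (v : V) (H : V → ℝ) (p : V) : ℝ :=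
  fderiv ℝ H p v

section DirDeriv

variable {V : Type*} [NormedAddCommGroup V] [NormedSpace ℝ V] {W : Set V} {H K : V → ℝ}

theorem contDiffOn_dirDeriv (hW : IsOpen W) (hH : ContDiffOn ℝ ∞ H W) (v : V) :
    ContDiffOn ℝ ∞ (dirDeriv v H) W :=
  (hH.fderiv_of_isOpen hW (by simp)).clm_apply contDiffOn_const

theorem differentiableAt_of_contDiffOn (hW : IsOpen W) (hH : ContDiffOn ℝ ∞ H W) {p : V}
    (hp : p ∈ W) : DifferentiableAt ℝ H p :=
  (hH.contDiffAt (hW.mem_nhds hp)).differentiableAt (by simp)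

theorem dirDeriv_congr (hW : IsOpen W) (h : Set.EqOn H K W) {p : V} (hp : p ∈ W) (v : V) :
    dirDeriv v H p = dirDeriv v K p := by
  unfold dirDeriv
  rw [(h.eventuallyEq_of_mem (hW.mem_nhds hp)).fderiv_eq]

theorem dirDeriv_comm (hW : IsOpen W) (hH : ContDiffOn ℝ ∞ H W) {p : V} (hp : p ∈ W) (v w : V) :
    dirDeriv v (dirDeriv w H) p = dirDeriv w (dirDeriv v H) p := by
  have hs : IsSymmSndFDerivAt ℝ H p :=
    (hH.contDiffAt (hW.mem_nhds hp)).isSymmSndFDerivAt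
      (by simpa using WithTop.coe_le_coe.mpr (le_top : (2 : ℕ∞) ≤ ⊤))
  have hd : DifferentiableAt ℝ (fderiv ℝ H) p :=
    ((hH.fderiv_of_isOpen (m := ∞) hW (by simp)).contDiffAt (hW.mem_nhds hp)).differentiableAt
      (by simp)
  have key : ∀ a b : V, dirDeriv a (dirDeriv b H) p = fderiv ℝ (fderiv ℝ H) p a b := by
    intro a b
    change fderiv ℝ (fun q => fderiv ℝ H q b) p a = _
    rw [fderiv_clm_apply hd (differentiableAt_const b)]
    simp
  rw [key, key, hs.eq]

end DirDeriv

theorem hasFDerivAt_fibre_coord (k : Fin n) (p : Model n × Model n) :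
    HasFDerivAt (fun q : Model n × Model n => q.2 k)
      ((EuclideanSpace.proj k : Model n →L[ℝ] ℝ).comp
        (ContinuousLinearMap.snd ℝ (Model n) (Model n))) p :=
  ((EuclideanSpace.proj k : Model n →L[ℝ] ℝ).comp
    (ContinuousLinearMap.snd ℝ (Model n) (Model n))).hasFDerivAt

theorem stdVec_apply (i j : Fin n) : stdVec i j = if j = i then (1 : ℝ) else 0 := by
  simp [stdVec]

/-- Leibniz rule for a contraction with the fibre coordinates. -/
theorem dirDeriv_sum_fibre_mul {H : Fin n → Model n × Model n → ℝ} {p : Model n × Model n}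
    (hH : ∀ k, DifferentiableAt ℝ (H k) p) (v : Model n × Model n) :
    dirDeriv v (fun q => ∑ k, q.2 k * H k q) p
      = (∑ k, v.2 k * H k p) + ∑ k, p.2 k * dirDeriv v (H k) p := by
  unfold dirDeriv
  rw [(HasFDerivAt.fun_sum fun k _ => (hasFDerivAt_fibre_coord k p).fun_mul
    (hH k).hasFDerivAt).fderiv]
  simp [Finset.sum_add_distrib, add_comm, mul_comm]

/-- Passing from partial derivatives with one variable frozen to derivatives on the product makes
base and fibre derivatives commute by `dirDeriv_comm`. -/
theorem pd_fibre {H : Model n × Model n → ℝ} {x y : Model n}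
    (hH : DifferentiableAt ℝ H (x, y)) (i : Fin n) :
    pd i (fun v => H (x, v)) y = dirDeriv (fibreDir i) H (x, y) := by
  have h := (HasFDerivAt.comp (g := H) (f := fun v => (x, v)) y hH.hasFDerivAt
    (hasFDerivAt_prodMk_right x y)).fderiv
  unfold pd dirDeriv
  rw [show (fun v => H (x, v)) = H ∘ (fun v => (x, v)) from rfl, h]
  simp [fibreDir]

theorem pd_base {H : Model n × Model n → ℝ} {x y : Model n}
    (hH : DifferentiableAt ℝ H (x, y)) (i : Fin n) :
    pd i (fun z => H (z, y)) x = dirDeriv (baseDir i) H (x, y) := by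
  have h := (HasFDerivAt.comp (g := H) (f := fun z => (z, y)) x hH.hasFDerivAt
    (hasFDerivAt_prodMk_left x y)).fderiv
  unfold pd dirDeriv
  rw [show (fun z => H (z, y)) = H ∘ (fun z => (z, y)) from rfl, h]
  simp [baseDir]

theorem pd_congr {u w : Model n → ℝ} {x : Model n} (h : u =ᶠ[nhds x] w) (i : Fin n) :
    pd i u x = pd i w x := by
  unfold pd; rw [h.fderiv_eq]

theorem eventually_fibre {W : Set (Model n × Model n)} (hW : IsOpen W) {x y : Model n}
    (hp : (x, y) ∈ W) : ∀ᶠ v in nhds y, (x, v) ∈ W :=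
  (Continuous.prodMk_right x).continuousAt.eventually (hW.mem_nhds hp)

theorem eventually_base {W : Set (Model n × Model n)} (hW : IsOpen W) {x y : Model n}
    (hp : (x, y) ∈ W) : ∀ᶠ z in nhds x, (z, y) ∈ W :=
  (Continuous.prodMk_left y).continuousAt.eventually (hW.mem_nhds hp)

/-- The function `F²` on `ℝⁿ × ℝⁿ`. -/
def energy (F : Model n → Model n → ℝ) (p : Model n × Model n) : ℝ := F p.1 p.2 ^ 2

/-! ### Euler relations, the spray and the Berwald connection. -/

section Spray

variable {F : Model n → Model n → ℝ} {W : Set (Model n × Model n)}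

theorem metricTensor_eq (hW : IsOpen W) (hF : ContDiffOn ℝ ∞ (energy F) W) {x y : Model n}
    (hp : (x, y) ∈ W) (i j : Fin n) :
    metricTensor F x y i j
      = (1 / 2 : ℝ) * dirDeriv (fibreDir i) (dirDeriv (fibreDir j) (energy F)) (x, y) := by
  have h1 := contDiffOn_dirDeriv hW hF (fibreDir j)
  rw [← pd_fibre (differentiableAt_of_contDiffOn hW h1 hp)]
  simp only [metricTensor, Matrix.of_apply]
  congr 1
  refine pd_congr ?_ i
  filter_upwards [eventually_fibre hW hp] with v hv
  exact pd_fibre (differentiableAt_of_contDiffOn hW hF hv) j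

theorem pd_metricTensor (hW : IsOpen W) (hF : ContDiffOn ℝ ∞ (energy F) W) {x y : Model n}
    (hp : (x, y) ∈ W) (i j k : Fin n) :
    pd k (fun z => metricTensor F z y i j) x
      = (1 / 2 : ℝ) * dirDeriv (baseDir k)
          (dirDeriv (fibreDir i) (dirDeriv (fibreDir j) (energy F))) (x, y) := by
  have h2 := contDiffOn_dirDeriv hW (contDiffOn_dirDeriv hW hF (fibreDir j)) (fibreDir i)
  have hd := differentiableAt_of_contDiffOn hW h2 hp
  have : (fun z => metricTensor F z y i j) =ᶠ[nhds x] fun z => (fun q => (1 / 2 : ℝ) *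
      dirDeriv (fibreDir i) (dirDeriv (fibreDir j) (energy F)) q) (z, y) := by
    filter_upwards [eventually_base hW hp] with z hz
    exact metricTensor_eq hW hF hz i j
  rw [pd_congr this, pd_base (hd.const_mul _)]
  unfold dirDeriv at hd ⊢
  rw [fderiv_const_mul hd]
  simp

/-- Euler's relation for `F²`. -/
theorem energy_euler (hW : IsOpen W) (hF : ContDiffOn ℝ ∞ (energy F) W)
    (hom : ∀ p ∈ W, ∀ c : ℝ, 0 < c → F p.1 (c • p.2) = c * F p.1 p.2) {p : Model n × Model n}
    (hp : p ∈ W) :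
    ∑ k, p.2 k * dirDeriv (fibreDir k) (energy F) p = 2 * energy F p := by
  -- The curve `c ↦ F²(x, c y)` is differentiated at `c = 1` in two ways: by the chain rule, and as
  -- `c² F²(x, y)`. Homogeneity for `c > 0` suffices, since only `c` near `1` matters.
  have hd := (differentiableAt_of_contDiffOn hW hF hp).hasFDerivAt
  have hc : HasDerivAt (fun c : ℝ => (p.1, c • p.2)) ((0 : Model n), p.2) 1 := by
    simpa using (hasDerivAt_const (1 : ℝ) p.1).prodMk
      ((hasDerivAt_id (1 : ℝ)).smul_const p.2)
  have h1 : HasDerivAt (fun c : ℝ => energy F (p.1, c • p.2)) (fderiv ℝ (energy F) p (0, p.2)) 1 :=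
    HasFDerivAt.comp_hasDerivAt (l := energy F) (f := fun c : ℝ => (p.1, c • p.2)) (1 : ℝ)
      (by simpa using hd) hc
  have h2 : HasDerivAt (fun c : ℝ => c ^ 2 * energy F p) (2 * energy F p) 1 := by
    simpa using (hasDerivAt_pow 2 (1 : ℝ)).mul_const (energy F p)
  have h3 : (fun c : ℝ => energy F (p.1, c • p.2)) =ᶠ[nhds 1] fun c => c ^ 2 * energy F p := by
    filter_upwards [lt_mem_nhds (zero_lt_one (α := ℝ))] with c hc
    simp only [energy]
    rw [hom p hp c hc, mul_pow]
  rw [h2.unique (h1.congr_of_eventuallyEq h3.symm)]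
  have hy : ((0 : Model n), p.2) = ∑ k, p.2 k • fibreDir k := by
    have : ∑ k, p.2 k • stdVec k = p.2 := by
      ext j
      simp [stdVec_apply, Finset.sum_apply]
    refine Prod.ext ?_ ?_
    · simp [Prod.fst_sum, fibreDir]
    · simp [Prod.snd_sum, fibreDir, this]
  rw [hy, map_sum]
  simp [dirDeriv]

theorem fibreDir_snd_sum (r : Fin n) (u : Fin n → ℝ) :
    ∑ k, (fibreDir r : Model n × Model n).2 k * u k = u r := by
  simp [fibreDir, stdVec_apply]

theorem baseDir_snd_sum (r : Fin n) (u : Fin n → ℝ) :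
    ∑ k, (baseDir r : Model n × Model n).2 k * u k = 0 := by
  simp [baseDir]

/-- Differentiate Euler's relation along `yʳ`: the Leibniz term from the factor `yᵏ` accounts for
one of the two copies of `∂F²/∂yʳ` on the right. -/
theorem sum_fibre_mul_fibre_fibre (hW : IsOpen W) (hF : ContDiffOn ℝ ∞ (energy F) W)
    (hom : ∀ p ∈ W, ∀ c : ℝ, 0 < c → F p.1 (c • p.2) = c * F p.1 p.2) {p : Model n × Model n}
    (hp : p ∈ W) (r : Fin n) :
    ∑ k, p.2 k * dirDeriv (fibreDir k) (dirDeriv (fibreDir r) (energy F)) p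
      = dirDeriv (fibreDir r) (energy F) p := by
  have hE := dirDeriv_congr (K := fun q => 2 * energy F q) hW
    (fun q hq => energy_euler hW hF hom hq) hp (fibreDir r)
  rw [dirDeriv_sum_fibre_mul (fun k => differentiableAt_of_contDiffOn hW
    (contDiffOn_dirDeriv hW hF _) hp), fibreDir_snd_sum] at hE
  have h2 : dirDeriv (fibreDir r) (fun q => 2 * energy F q) p
      = 2 * dirDeriv (fibreDir r) (energy F) p := by
    unfold dirDeriv
    rw [fderiv_const_mul (differentiableAt_of_contDiffOn hW hF hp)]; simp
  rw [h2] at hE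
  simp only [dirDeriv_comm hW hF hp (fibreDir _) (fibreDir r)]
  linarith

/-- A base derivative of the preceding relation; the factors `yᵏ` are constant along the base, so no
Leibniz term appears. -/
theorem sum_fibre_mul_base_fibre_fibre (hW : IsOpen W) (hF : ContDiffOn ℝ ∞ (energy F) W)
    (hom : ∀ p ∈ W, ∀ c : ℝ, 0 < c → F p.1 (c • p.2) = c * F p.1 p.2) {p : Model n × Model n}
    (hp : p ∈ W) (r j : Fin n) :
    ∑ k, p.2 k * dirDeriv (baseDir j) (dirDeriv (fibreDir k) (dirDeriv (fibreDir r) (energy F))) p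
      = dirDeriv (baseDir j) (dirDeriv (fibreDir r) (energy F)) p := by
  rw [← dirDeriv_congr hW (fun q hq => sum_fibre_mul_fibre_fibre hW hF hom hq r) hp,
    dirDeriv_sum_fibre_mul (fun k => differentiableAt_of_contDiffOn hW
      (contDiffOn_dirDeriv hW (contDiffOn_dirDeriv hW hF _) _) hp), baseDir_snd_sum, zero_add]

theorem sum_fibre_mul_base_fibre (hW : IsOpen W) (hF : ContDiffOn ℝ ∞ (energy F) W)
    (hom : ∀ p ∈ W, ∀ c : ℝ, 0 < c → F p.1 (c • p.2) = c * F p.1 p.2) {p : Model n × Model n}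
    (hp : p ∈ W) (j : Fin n) :
    ∑ k, p.2 k * dirDeriv (baseDir j) (dirDeriv (fibreDir k) (energy F)) p
      = 2 * dirDeriv (baseDir j) (energy F) p := by
  have h2 : dirDeriv (baseDir j) (fun q => 2 * energy F q) p
      = 2 * dirDeriv (baseDir j) (energy F) p := by
    unfold dirDeriv
    rw [fderiv_const_mul (differentiableAt_of_contDiffOn hW hF hp)]; simp
  rw [← h2, ← dirDeriv_congr hW (fun q hq => energy_euler hW hF hom hq) hp,
    dirDeriv_sum_fibre_mul (fun k => differentiableAt_of_contDiffOn hW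
      (contDiffOn_dirDeriv hW hF _) hp), baseDir_snd_sum, zero_add]

/-- The spray coefficients in terms of `F²`. -/
theorem sprayCoeff_eq_energy (hW : IsOpen W) (hF : ContDiffOn ℝ ∞ (energy F) W)
    (hom : ∀ p ∈ W, ∀ c : ℝ, 0 < c → F p.1 (c • p.2) = c * F p.1 p.2) {x y : Model n}
    (hp : (x, y) ∈ W) (i : Fin n) :
    sprayCoeff F x y i = (1 / 4 : ℝ) * ∑ r, (metricTensor F x y)⁻¹ i r *
      (∑ j, y j * dirDeriv (baseDir j) (dirDeriv (fibreDir r) (energy F)) (x, y)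
        - dirDeriv (baseDir r) (energy F) (x, y)) := by
  set T := fun a b c : Fin n => dirDeriv (baseDir a)
    (dirDeriv (fibreDir b) (dirDeriv (fibreDir c) (energy F))) (x, y) with hT
  have hA : ∀ r j, ∑ k, y k * T j k r
      = dirDeriv (baseDir j) (dirDeriv (fibreDir r) (energy F)) (x, y) :=
    fun r j => sum_fibre_mul_base_fibre_fibre hW hF hom hp r j
  have hB : ∀ r, ∑ k, y k * dirDeriv (baseDir r) (dirDeriv (fibreDir k) (energy F)) (x, y)
      = 2 * dirDeriv (baseDir r) (energy F) (x, y) :=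
    fun r => sum_fibre_mul_base_fibre hW hF hom hp r
  -- Contracted with `yʲ yᵏ`, the first two terms of the Christoffel bracket agree after renaming
  -- indices, and the third collapses by applying Euler twice.
  have hr : ∀ r, ∑ j, ∑ k, (T j k r + T k j r - T r j k) * y j * y k
      = 2 * (∑ j, y j * dirDeriv (baseDir j) (dirDeriv (fibreDir r) (energy F)) (x, y)
        - dirDeriv (baseDir r) (energy F) (x, y)) := by
    intro r
    have e1 : ∑ j, ∑ k, T j k r * y j * y k
        = ∑ j, y j * dirDeriv (baseDir j) (dirDeriv (fibreDir r) (energy F)) (x, y) := by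
      refine Finset.sum_congr rfl fun j _ => ?_
      rw [← hA, Finset.mul_sum]
      exact Finset.sum_congr rfl fun k _ => by ring
    have e2 : ∑ j, ∑ k, T k j r * y j * y k = ∑ j, ∑ k, T j k r * y j * y k := by
      rw [Finset.sum_comm]
      exact Finset.sum_congr rfl fun j _ => Finset.sum_congr rfl fun k _ => by ring
    have e3 : ∑ j, ∑ k, T r j k * y j * y k = 2 * dirDeriv (baseDir r) (energy F) (x, y) := by
      rw [← hB, Finset.sum_comm]
      refine Finset.sum_congr rfl fun k _ => ?_
      rw [← hA, Finset.mul_sum]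
      exact Finset.sum_congr rfl fun j _ => by ring
    simp only [sub_mul, add_mul, Finset.sum_sub_distrib, Finset.sum_add_distrib]
    rw [e2, e1, e3]; ring
  have hc : ∀ j k, christoffel (fun z => metricTensor F z y) x i j k * y j * y k
      = ∑ r, (1 / 4 : ℝ) * ((metricTensor F x y)⁻¹ i r
          * ((T j k r + T k j r - T r j k) * y j * y k)) := by
    intro j k
    simp only [christoffel, pd_metricTensor hW hF hp]
    rw [Finset.mul_sum, Finset.sum_mul, Finset.sum_mul]
    exact Finset.sum_congr rfl fun r _ => by simp only [hT]; ring
  have hs : ∑ j, ∑ k, christoffel (fun z => metricTensor F z y) x i j k * y j * y k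
      = ∑ r, (1 / 4 : ℝ) * ((metricTensor F x y)⁻¹ i r
          * ∑ j, ∑ k, (T j k r + T k j r - T r j k) * y j * y k) := by
    simp only [hc, Finset.mul_sum]
    rw [Finset.sum_congr rfl fun j _ => Finset.sum_comm, Finset.sum_comm]
  rw [sprayCoeff, hs, Finset.mul_sum, Finset.mul_sum]
  exact Finset.sum_congr rfl fun r _ => by rw [hr]; ring

/-- If `F²` is constant along the horizontal distribution of a symmetric linear connection `Γ`,
then the spray of `F` is that of `Γ`. -/
theorem sprayCoeff_eq_of_horizontal (hW : IsOpen W) (hF : ContDiffOn ℝ ∞ (energy F) W)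
    (hom : ∀ p ∈ W, ∀ c : ℝ, 0 < c → F p.1 (c • p.2) = c * F p.1 p.2)
    {Γ : Fin n → Fin n → Fin n → ℝ} (hΓ : ∀ i j k, Γ i j k = Γ i k j) {x y : Model n}
    (hp : (x, y) ∈ W) (hdet : (metricTensor F x y).det ≠ 0)
    (hhor : ∀ v, (x, v) ∈ W → ∀ k, dirDeriv (baseDir k) (energy F) (x, v)
      = ∑ j, v j * ∑ i, Γ i k j * dirDeriv (fibreDir i) (energy F) (x, v)) (i : Fin n) :
    sprayCoeff F x y i = (1 / 2 : ℝ) * ∑ j, ∑ k, Γ i j k * y j * y k := by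
  set D := fun a => dirDeriv (fibreDir a) (energy F) (x, y) with hD
  have hdF : ∀ a, DifferentiableAt ℝ (dirDeriv (fibreDir a) (energy F)) (x, y) := fun a =>
    differentiableAt_of_contDiffOn hW (contDiffOn_dirDeriv hW hF _) hp
  -- The fibre derivative of the horizontality condition. Only `y` varies, so the condition is
  -- needed at the single base point `x` and `Γ` is constant; the first sum is the Leibniz term of
  -- `yʲ`.
  have hmix : ∀ k r, dirDeriv (baseDir k) (dirDeriv (fibreDir r) (energy F)) (x, y)
      = ∑ i, Γ i k r * D i
        + ∑ j, y j * ∑ i, Γ i k j *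
          dirDeriv (fibreDir i) (dirDeriv (fibreDir r) (energy F)) (x, y) := by
    intro k r
    have hd1 := differentiableAt_of_contDiffOn hW (contDiffOn_dirDeriv hW hF (baseDir k)) hp
    have hd2 : ∀ j, DifferentiableAt ℝ
        (fun q => ∑ i, Γ i k j * dirDeriv (fibreDir i) (energy F) q) (x, y) := fun j =>
      DifferentiableAt.fun_sum fun i _ => (hdF i).const_mul _
    have hd3 : DifferentiableAt ℝ (fun q : Model n × Model n =>
        ∑ j, q.2 j * ∑ i, Γ i k j * dirDeriv (fibreDir i) (energy F) q) (x, y) :=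
      DifferentiableAt.fun_sum fun j _ => (hasFDerivAt_fibre_coord j _).differentiableAt.mul (hd2 j)
    rw [dirDeriv_comm hW hF hp, ← pd_fibre hd1]
    have hev : (fun v => dirDeriv (baseDir k) (energy F) (x, v)) =ᶠ[nhds y]
        fun v => (fun q : Model n × Model n =>
          ∑ j, q.2 j * ∑ i, Γ i k j * dirDeriv (fibreDir i) (energy F) q) (x, v) := by
      filter_upwards [eventually_fibre hW hp] with v hv using hhor v hv k
    rw [pd_congr hev, pd_fibre hd3, dirDeriv_sum_fibre_mul hd2, fibreDir_snd_sum]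
    congr 1
    refine Finset.sum_congr rfl fun j _ => ?_
    congr 1
    change fderiv ℝ (fun q => ∑ i, Γ i k j * dirDeriv (fibreDir i) (energy F) q) (x, y)
      (fibreDir r) = _
    rw [(HasFDerivAt.fun_sum fun i _ => ((hdF i).hasFDerivAt.const_mul (Γ i k j))).fderiv]
    simp only [sum_apply, smul_apply, smul_eq_mul]
    refine Finset.sum_congr rfl fun i _ => ?_
    rw [dirDeriv_comm hW hF hp (fibreDir i)]
    rfl
  have hr : ∀ r, ∑ k, y k * dirDeriv (baseDir k) (dirDeriv (fibreDir r) (energy F)) (x, y)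
        - dirDeriv (baseDir r) (energy F) (x, y)
      = ∑ l, (2 * ∑ j, ∑ k, Γ l j k * y j * y k) * metricTensor F x y l r := by
    intro r
    simp only [metricTensor_eq hW hF hp, hmix, mul_add, Finset.sum_add_distrib]
    -- Symmetry of `Γ` turns the contracted Leibniz term back into the right side of the
    -- horizontality condition, so it cancels `∂ᵣ F²`.
    have e1 : ∑ k, y k * ∑ i, Γ i k r * D i = dirDeriv (baseDir r) (energy F) (x, y) := by
      rw [hhor y hp r]
      refine Finset.sum_congr rfl fun k _ => ?_
      congr 1
      exact Finset.sum_congr rfl fun i _ => by rw [hΓ i k r]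
    rw [e1, add_sub_cancel_left]
    simp only [Finset.mul_sum, Finset.sum_mul]
    rw [Finset.sum_congr rfl fun k _ => Finset.sum_comm, Finset.sum_comm]
    exact Finset.sum_congr rfl fun l _ => Finset.sum_congr rfl fun k _ =>
      Finset.sum_congr rfl fun j _ => by ring
  have hsymm : ∀ a b, metricTensor F x y a b = metricTensor F x y b a := by
    intro a b
    rw [metricTensor_eq hW hF hp, metricTensor_eq hW hF hp, dirDeriv_comm hW hF hp]
  have hinv : ∀ l, ∑ r, (metricTensor F x y)⁻¹ i r * metricTensor F x y r l
      = if i = l then 1 else 0 := by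
    intro l
    rw [← Matrix.mul_apply, Matrix.nonsing_inv_mul _ (isUnit_iff_ne_zero.mpr hdet),
      Matrix.one_apply]
  rw [sprayCoeff_eq_energy hW hF hom hp]
  have hsum : ∑ r, (metricTensor F x y)⁻¹ i r *
      ∑ l, (2 * ∑ j, ∑ k, Γ l j k * y j * y k) * metricTensor F x y l r
      = ∑ l, ∑ r, (metricTensor F x y)⁻¹ i r *
        ((2 * ∑ j, ∑ k, Γ l j k * y j * y k) * metricTensor F x y l r) := by
    rw [Finset.sum_comm]
    exact Finset.sum_congr rfl fun r _ => Finset.mul_sum _ _ _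
  have : ∀ l, ∑ r, (metricTensor F x y)⁻¹ i r *
      ((2 * ∑ j, ∑ k, Γ l j k * y j * y k) * metricTensor F x y l r)
      = (2 * ∑ j, ∑ k, Γ l j k * y j * y k) * if i = l then 1 else 0 := by
    intro l
    rw [← hinv l, Finset.mul_sum (s := Finset.univ) (f := fun r => _ * metricTensor F x y r l)]
    exact Finset.sum_congr rfl fun r _ => by rw [hsymm l r]; ring
  simp only [hr, hsum, this, mul_ite, mul_one, mul_zero, Finset.sum_ite_eq, Finset.mem_univ,
    if_true]
  ring

theorem pd_quadratic (C : Fin n → Fin n → ℝ) (hC : ∀ j k, C j k = C k j) (y : Model n)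
    (r : Fin n) :
    pd r (fun v => (1 / 2 : ℝ) * ∑ j, ∑ k, C j k * v j * v k) y = ∑ k, C r k * y k := by
  have hc : ∀ j : Fin n, HasFDerivAt (fun v : Model n => v j)
      (EuclideanSpace.proj j : Model n →L[ℝ] ℝ) y := fun j =>
    (EuclideanSpace.proj j : Model n →L[ℝ] ℝ).hasFDerivAt
  have h := (HasFDerivAt.fun_sum (u := Finset.univ) fun j _ =>
    HasFDerivAt.fun_sum (u := Finset.univ) fun k _ =>
      ((hc j).const_mul (C j k)).fun_mul (hc k)).const_mul (1 / 2 : ℝ)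
  unfold pd
  rw [h.fderiv]
  simp only [sum_apply, smul_apply, smul_eq_mul, add_apply,
    PiLp.proj_apply, stdVec_apply, Finset.sum_add_distrib]
  have e1 : ∑ j, ∑ k, C j k * y j * (if k = r then (1 : ℝ) else 0) = ∑ k, C r k * y k := by
    simp [fun j => hC j r]
  have e2 : ∑ j, ∑ k, y k * (C j k * if j = r then (1 : ℝ) else 0) = ∑ k, C r k * y k := by
    rw [Finset.sum_comm]
    simp [mul_comm]
  rw [e1, e2]; ring

theorem pd_linear (C : Fin n → ℝ) (y : Model n) (r : Fin n) :
    pd r (fun v => ∑ k, C k * v k) y = C r := by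
  have hc : ∀ j : Fin n, HasFDerivAt (fun v : Model n => v j)
      (EuclideanSpace.proj j : Model n →L[ℝ] ℝ) y := fun j =>
    (EuclideanSpace.proj j : Model n →L[ℝ] ℝ).hasFDerivAt
  unfold pd
  rw [(HasFDerivAt.fun_sum (u := Finset.univ) fun k _ => (hc k).const_mul (C k)).fderiv]
  simp [stdVec_apply]

/-- If `F²` is constant along the horizontal distribution of a symmetric linear connection `Γ`,
then the Berwald connection of `F` is `Γ`. -/
theorem berwaldCoeff_eq_of_horizontal (hW : IsOpen W) (hF : ContDiffOn ℝ ∞ (energy F) W)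
    (hom : ∀ p ∈ W, ∀ c : ℝ, 0 < c → F p.1 (c • p.2) = c * F p.1 p.2)
    (hdet : ∀ p ∈ W, (metricTensor F p.1 p.2).det ≠ 0)
    {Γ : Fin n → Fin n → Fin n → ℝ} (hΓ : ∀ i j k, Γ i j k = Γ i k j) {x : Model n}
    (hhor : ∀ v, (x, v) ∈ W → ∀ k, dirDeriv (baseDir k) (energy F) (x, v)
      = ∑ j, v j * ∑ i, Γ i k j * dirDeriv (fibreDir i) (energy F) (x, v)) {y : Model n}
    (hp : (x, y) ∈ W) (i j k : Fin n) :
    berwaldCoeff F x y i j k = Γ i j k := by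
  -- The formula is needed for all `v` near `y`, since it is differentiated once more along the
  -- fibre.
  have hN : ∀ v, (x, v) ∈ W → barthelCoeff F x v i j = ∑ k, Γ i j k * v k := by
    intro v hv
    rw [← pd_quadratic (Γ i) (hΓ i)]
    refine pd_congr ?_ j
    filter_upwards [eventually_fibre hW hv] with w hw
    exact sprayCoeff_eq_of_horizontal hW hF hom hΓ hw (hdet (x, w) hw) hhor i
  rw [← pd_linear (Γ i j) y k]
  refine pd_congr ?_ k
  filter_upwards [eventually_fibre hW hp] with v hv using hN v hv

end Spray

end Coordinates

/-! ### Horizontal constancy of the change in coordinates. -/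

section Change

variable {n : ℕ}

theorem christoffel_symm {a : Model n → Matrix (Fin n) (Fin n) ℝ}
    (ha : ∀ z i j, a z i j = a z j i) (x : Model n) (i j k : Fin n) :
    christoffel a x i j k = christoffel a x i k j := by
  unfold christoffel
  congr 1
  refine Finset.sum_congr rfl fun r _ => ?_
  rw [show (fun z => a z j k) = fun z => a z k j from funext fun z => ha z j k]
  ring

/-- The Christoffel symbols of the first kind. -/
theorem sum_mul_christoffel {a : Model n → Matrix (Fin n) (Fin n) ℝ} {x : Model n}
    (hdet : (a x).det ≠ 0) (l j k : Fin n) :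
    ∑ i, a x l i * christoffel a x i j k = (1 / 2 : ℝ) *
      (pd j (fun z => a z k l) x + pd k (fun z => a z j l) x - pd l (fun z => a z j k) x) := by
  have hinv : ∀ r, ∑ i, a x l i * (a x)⁻¹ i r = if l = r then 1 else 0 := by
    intro r
    rw [← Matrix.mul_apply, Matrix.mul_nonsing_inv _ (isUnit_iff_ne_zero.mpr hdet),
      Matrix.one_apply]
  set D := fun r => pd j (fun z => a z k r) x + pd k (fun z => a z j r) x
    - pd r (fun z => a z j k) x with hD
  have h1 : ∑ i, a x l i * christoffel a x i j k
      = ∑ r, (1 / 2 : ℝ) * D r * ∑ i, a x l i * (a x)⁻¹ i r := by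
    simp only [christoffel, Finset.mul_sum]
    rw [Finset.sum_comm]
    exact Finset.sum_congr rfl fun r _ => Finset.sum_congr rfl fun i _ => by simp only [hD]; ring
  rw [h1]
  simp [hinv, hD]

/-- The quadratic form `aᵢⱼ(x) yⁱ yʲ`. -/
def quadForm (a : Model n → Matrix (Fin n) (Fin n) ℝ) (p : Model n × Model n) : ℝ :=
  ∑ i, ∑ j, a p.1 i j * p.2 i * p.2 j

/-- The linear form `bᵢ(x) yⁱ`. -/
def linForm (b : Fin n → Model n → ℝ) (p : Model n × Model n) : ℝ :=
  ∑ i, b i p.1 * p.2 i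

theorem hasFDerivAt_comp_fst {u : Model n → ℝ} {p : Model n × Model n}
    (hu : DifferentiableAt ℝ u p.1) :
    HasFDerivAt (fun q : Model n × Model n => u q.1)
      ((fderiv ℝ u p.1).comp (ContinuousLinearMap.fst ℝ (Model n) (Model n))) p :=
  HasFDerivAt.comp (g := u) (f := Prod.fst) p hu.hasFDerivAt hasFDerivAt_fst

theorem differentiableAt_quadForm {a : Model n → Matrix (Fin n) (Fin n) ℝ} {p : Model n × Model n}
    (ha : ∀ i j, DifferentiableAt ℝ (fun z => a z i j) p.1) :
    DifferentiableAt ℝ (quadForm a) p :=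
  DifferentiableAt.fun_sum fun i _ => DifferentiableAt.fun_sum fun j _ =>
    ((hasFDerivAt_comp_fst (ha i j)).differentiableAt.fun_mul
      (hasFDerivAt_fibre_coord i p).differentiableAt).fun_mul
      (hasFDerivAt_fibre_coord j p).differentiableAt

theorem differentiableAt_linForm {b : Fin n → Model n → ℝ} {p : Model n × Model n}
    (hb : ∀ i, DifferentiableAt ℝ (b i) p.1) : DifferentiableAt ℝ (linForm b) p :=
  DifferentiableAt.fun_sum fun i _ =>
    (hasFDerivAt_comp_fst (hb i)).differentiableAt.fun_mul
      (hasFDerivAt_fibre_coord i p).differentiableAt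

theorem fderiv_quadForm {a : Model n → Matrix (Fin n) (Fin n) ℝ} {p : Model n × Model n}
    (ha : ∀ i j, DifferentiableAt ℝ (fun z => a z i j) p.1) (w : Model n × Model n) :
    fderiv ℝ (quadForm a) p w
      = ∑ i, ∑ j, (fderiv ℝ (fun z => a z i j) p.1 w.1 * p.2 i * p.2 j
        + a p.1 i j * w.2 i * p.2 j + a p.1 i j * p.2 i * w.2 j) := by
  have h := HasFDerivAt.fun_sum (u := Finset.univ) fun i _ =>
    HasFDerivAt.fun_sum (u := Finset.univ) fun j _ =>
    ((hasFDerivAt_comp_fst (ha i j)).fun_mul (hasFDerivAt_fibre_coord i p)).fun_mul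
      (hasFDerivAt_fibre_coord j p)
  unfold quadForm
  rw [h.fderiv]
  simp only [sum_apply, smul_apply, smul_eq_mul, add_apply, ContinuousLinearMap.comp_apply,
    ContinuousLinearMap.coe_fst', ContinuousLinearMap.coe_snd', PiLp.proj_apply]
  exact Finset.sum_congr rfl fun i _ => Finset.sum_congr rfl fun j _ => by ring

theorem fderiv_linForm {b : Fin n → Model n → ℝ} {p : Model n × Model n}
    (hb : ∀ i, DifferentiableAt ℝ (b i) p.1) (w : Model n × Model n) :
    fderiv ℝ (linForm b) p w
      = ∑ i, (fderiv ℝ (b i) p.1 w.1 * p.2 i + b i p.1 * w.2 i) := by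
  have h := HasFDerivAt.fun_sum (u := Finset.univ) fun i _ =>
    (hasFDerivAt_comp_fst (hb i)).fun_mul (hasFDerivAt_fibre_coord i p)
  unfold linForm
  rw [h.fderiv]
  simp only [sum_apply, smul_apply, smul_eq_mul, add_apply, ContinuousLinearMap.comp_apply,
    ContinuousLinearMap.coe_fst', ContinuousLinearMap.coe_snd', PiLp.proj_apply]
  exact Finset.sum_congr rfl fun i _ => by ring

/-- The horizontal lift of `∂ₖ` at `(x, y)` for the linear connection `Γ`. -/
def horizontalLift (Γ : Fin n → Fin n → Fin n → ℝ) (y : Model n) (k : Fin n) : Model n × Model n :=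
  baseDir k - ∑ j, y j • ∑ i, Γ i k j • fibreDir i

theorem horizontalLift_fst (Γ : Fin n → Fin n → Fin n → ℝ) (y : Model n) (k : Fin n) :
    (horizontalLift Γ y k).1 = stdVec k := by
  simp [horizontalLift, baseDir, fibreDir, Prod.fst_sum]

theorem horizontalLift_snd (Γ : Fin n → Fin n → Fin n → ℝ) (y : Model n) (k i : Fin n) :
    (horizontalLift Γ y k).2 i = -∑ j, Γ i k j * y j := by
  simp [horizontalLift, baseDir, fibreDir, Prod.snd_sum, Finset.sum_apply, stdVec_apply, mul_comm]

/-- A metric is parallel for its Levi-Civita connection. -/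
theorem fderiv_quadForm_horizontalLift {a : Model n → Matrix (Fin n) (Fin n) ℝ}
    (hsymm : ∀ z i j, a z i j = a z j i) {p : Model n × Model n}
    (ha : ∀ i j, DifferentiableAt ℝ (fun z => a z i j) p.1) (hdet : (a p.1).det ≠ 0) (k : Fin n) :
    fderiv ℝ (quadForm a) p (horizontalLift (christoffel a p.1) p.2 k) = 0 := by
  rw [fderiv_quadForm ha]
  simp only [horizontalLift_fst, horizontalLift_snd, Finset.sum_add_distrib]
  set y := p.2
  set d := fun k i j => pd k (fun z => a z i j) p.1 with hd
  have hds : ∀ k i j, d k i j = d k j i := fun k i j => by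
    simp only [hd]
    rw [show (fun z => a z i j) = fun z => a z j i from funext fun z => hsymm z i j]
  set S := ∑ j, ∑ l, d k j l * y j * y l with hS
  -- Lowering the index gives Christoffel symbols of the first kind; two of their three terms cancel
  -- by antisymmetry in `i, l` against `yⁱ yˡ`. Each fibre slot of the form thus contributes `-S/2`,
  -- which together cancel the base derivative `S`.
  have h1 : ∑ i, ∑ j, a p.1 i j * y i * (-∑ l, christoffel a p.1 j k l * y l)
      = -((1 / 2 : ℝ) * S) := by
    have : ∀ i, ∑ j, a p.1 i j * y i * (-∑ l, christoffel a p.1 j k l * y l)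
        = -∑ l, (1 / 2 : ℝ) * (d k l i + d l k i - d i k l) * y i * y l := by
      intro i
      simp only [hd, ← sum_mul_christoffel hdet, Finset.sum_mul, Finset.mul_sum, mul_neg,
        Finset.sum_neg_distrib]
      rw [Finset.sum_comm]
      congr 1
      exact Finset.sum_congr rfl fun l _ => Finset.sum_congr rfl fun j _ => by ring
    simp only [this, Finset.sum_neg_distrib]
    congr 1
    have e : ∑ i, ∑ l, d l k i * y i * y l = ∑ i, ∑ l, d i k l * y i * y l := by
      rw [Finset.sum_comm]
      exact Finset.sum_congr rfl fun _ _ => Finset.sum_congr rfl fun _ _ => by ring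
    have e' : ∑ i, ∑ l, d k l i * y i * y l = S :=
      Finset.sum_congr rfl fun i _ => Finset.sum_congr rfl fun l _ => by rw [hds]
    have : ∑ i, ∑ l, (1 / 2 : ℝ) * (d k l i + d l k i - d i k l) * y i * y l
        = (1 / 2 : ℝ) * (∑ i, ∑ l, d k l i * y i * y l + ∑ i, ∑ l, d l k i * y i * y l
          - ∑ i, ∑ l, d i k l * y i * y l) := by
      simp only [← Finset.sum_add_distrib, ← Finset.sum_sub_distrib, Finset.mul_sum]
      exact Finset.sum_congr rfl fun _ _ => Finset.sum_congr rfl fun _ _ => by ring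
    rw [this, e, e']; ring
  have h2 : ∑ i, ∑ j, a p.1 i j * (-∑ l, christoffel a p.1 i k l * y l) * y j
      = -((1 / 2 : ℝ) * S) := by
    rw [← h1, Finset.sum_comm]
    exact Finset.sum_congr rfl fun i _ => Finset.sum_congr rfl fun j _ => by
      rw [hsymm _ j i]; ring
  rw [h1, h2]
  change S + _ + _ = 0
  ring

/-- The vertical part of the lift contributes `-Γʳₖᵢ bᵣ yⁱ`, which parallelism matches with `∂ₖ bᵢ
yⁱ`. Any coefficients `Γ` will do here. -/
theorem fderiv_linForm_horizontalLift {b : Fin n → Model n → ℝ} {Γ : Fin n → Fin n → Fin n → ℝ}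
    {p : Model n × Model n} (hb : ∀ i, DifferentiableAt ℝ (b i) p.1) (k : Fin n)
    (hpar : ∀ i, pd k (b i) p.1 - ∑ r, Γ r k i * b r p.1 = 0) :
    fderiv ℝ (linForm b) p (horizontalLift Γ p.2 k) = 0 := by
  rw [fderiv_linForm hb]
  simp only [horizontalLift_fst, horizontalLift_snd, Finset.sum_add_distrib]
  have h1 : ∑ i, fderiv ℝ (b i) p.1 (stdVec k) * p.2 i
      = ∑ i, (∑ r, Γ r k i * b r p.1) * p.2 i :=
    Finset.sum_congr rfl fun i _ => by rw [← sub_eq_zero.mp (hpar i)]; rfl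
  rw [h1]
  simp only [Finset.sum_mul, Finset.mul_sum, mul_neg, Finset.sum_neg_distrib]
  rw [Finset.sum_comm, add_neg_eq_zero]
  exact Finset.sum_congr rfl fun i _ => Finset.sum_congr rfl fun j _ => by ring

/-- The generalized `β`-conformal change in coordinates. -/
def coordChange (f : ℝ × ℝ → ℝ) (s : Model n → ℝ) (a : Model n → Matrix (Fin n) (Fin n) ℝ)
    (b : Fin n → Model n → ℝ) (p : Model n × Model n) : ℝ :=
  f (Real.exp (s p.1) * Real.sqrt (quadForm a p), linForm b p)

/-- Chain rule: the differentials of `s`, the quadratic form and the linear form all vanish on the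
lift. The differentiability clause is kept for squaring in `energy_horizontal`; `quadForm a p ≠ 0`
makes the square root differentiable. -/
theorem fderiv_coordChange_horizontalLift {f : ℝ × ℝ → ℝ} {s : Model n → ℝ}
    {a : Model n → Matrix (Fin n) (Fin n) ℝ} {b : Fin n → Model n → ℝ} {p : Model n × Model n}
    (hf : DifferentiableAt ℝ f (Real.exp (s p.1) * Real.sqrt (quadForm a p), linForm b p))
    (hs : HasFDerivAt s (0 : Model n →L[ℝ] ℝ) p.1)
    (hsymm : ∀ z i j, a z i j = a z j i)
    (ha : ∀ i j, DifferentiableAt ℝ (fun z => a z i j) p.1) (hdet : (a p.1).det ≠ 0)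
    (hq : quadForm a p ≠ 0) (hb : ∀ i, DifferentiableAt ℝ (b i) p.1) (k : Fin n)
    (hpar : ∀ i, pd k (b i) p.1 - ∑ r, christoffel a p.1 r k i * b r p.1 = 0) :
    HasFDerivAt (coordChange f s a b) (fderiv ℝ (coordChange f s a b) p) p ∧
    fderiv ℝ (coordChange f s a b) p (horizontalLift (christoffel a p.1) p.2 k) = 0 := by
  have h1 : HasFDerivAt (fun q : Model n × Model n => Real.exp (s q.1))
      (Real.exp (s p.1) • ((0 : Model n →L[ℝ] ℝ).comp
        (ContinuousLinearMap.fst ℝ (Model n) (Model n)))) p :=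
    (HasFDerivAt.comp (g := s) (f := Prod.fst) p hs hasFDerivAt_fst).exp
  have h2 := (differentiableAt_quadForm ha).hasFDerivAt.sqrt hq
  have h3 := (h1.fun_mul h2).prodMk (differentiableAt_linForm hb).hasFDerivAt
  have h4 := HasFDerivAt.comp (g := f) p hf.hasFDerivAt h3
  have h5 : HasFDerivAt (coordChange f s a b) _ p := h4
  refine ⟨h5.differentiableAt.hasFDerivAt, ?_⟩
  rw [h5.fderiv]
  simp only [ContinuousLinearMap.comp_apply, ContinuousLinearMap.prod_apply, add_apply, smul_apply,
    zero_apply, fderiv_quadForm_horizontalLift hsymm ha hdet k,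
    fderiv_linForm_horizontalLift hb k hpar, smul_zero, add_zero]
  exact map_zero _

/-- If `F` is given near `(x, y)` by the change, `F²` is horizontally constant at `(x, y)`. -/
theorem energy_horizontal {f : ℝ × ℝ → ℝ} {s : Model n → ℝ} {F : Model n → Model n → ℝ}
    {a : Model n → Matrix (Fin n) (Fin n) ℝ} {b : Fin n → Model n → ℝ} {p : Model n × Model n}
    (hF : (fun q : Model n × Model n => F q.1 q.2) =ᶠ[nhds p] coordChange f s a b)
    (hf : DifferentiableAt ℝ f (Real.exp (s p.1) * Real.sqrt (quadForm a p), linForm b p))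
    (hs : HasFDerivAt s (0 : Model n →L[ℝ] ℝ) p.1)
    (hsymm : ∀ z i j, a z i j = a z j i)
    (ha : ∀ i j, DifferentiableAt ℝ (fun z => a z i j) p.1) (hdet : (a p.1).det ≠ 0)
    (hq : quadForm a p ≠ 0) (hb : ∀ i, DifferentiableAt ℝ (b i) p.1) (k : Fin n)
    (hpar : ∀ i, pd k (b i) p.1 - ∑ r, christoffel a p.1 r k i * b r p.1 = 0) :
    dirDeriv (baseDir k) (energy F) p
      = ∑ j, p.2 j * ∑ i, christoffel a p.1 i k j * dirDeriv (fibreDir i) (energy F) p := by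
  obtain ⟨h1, h2⟩ := fderiv_coordChange_horizontalLift hf hs hsymm ha hdet hq hb k hpar
  have h3 : HasFDerivAt (energy F) _ p := (h1.congr_of_eventuallyEq hF).pow 2
  have h4 : fderiv ℝ (energy F) p (horizontalLift (christoffel a p.1) p.2 k) = 0 := by
    rw [h3.fderiv]; simp [h2]
  simp only [horizontalLift, map_sub, map_sum, map_smul, smul_eq_mul] at h4
  exact sub_eq_zero.mp h4

end Change

/-! ### Smoothness and nondegeneracy of chart components. -/

section Chart

variable {n : ℕ} {M : Type*} [TopologicalSpace M] [ChartedSpace (Model n) M]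
  {φ : OpenPartialHomeomorph M (Model n)}

theorem contMDiff_tangentBundle_mk :
    ContMDiff 𝓘(ℝ, Model n × Model n) (𝓡 n).tangent ∞
      (fun p : Model n × Model n => (⟨p.1, p.2⟩ : TangentBundle (𝓡 n) (Model n))) := by
  intro p
  rw [Bundle.contMDiffAt_totalSpace]
  refine ⟨contDiff_fst.contMDiff.contMDiffAt, ?_⟩
  simp
  exact contDiff_snd.contMDiff.contMDiffAt

theorem tangentPoint_eq {x : Model n} (hx : x ∈ φ.target) (y : Model n) :
    tangentPoint φ x y = tangentMapWithin (𝓡 n) (𝓡 n) φ.symm φ.target ⟨x, y⟩ := by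
  simp only [tangentPoint, tangentMapWithin]
  rw [mfderivWithin_of_isOpen φ.open_target hx]

theorem contMDiffOn_tangentPoint [IsManifold (𝓡 n) ∞ M]
    (hφ : φ ∈ IsManifold.maximalAtlas (𝓡 n) ∞ M) :
    ContMDiffOn 𝓘(ℝ, Model n × Model n) (𝓡 n).tangent ∞
      (fun p : Model n × Model n => tangentPoint φ p.1 p.2) (Prod.fst ⁻¹' φ.target) := by
  have h := (contMDiffOn_symm_of_mem_maximalAtlas hφ).contMDiffOn_tangentMapWithin (m := ∞)
    (by simp) φ.open_target.uniqueMDiffOn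
  exact (h.comp (contMDiff_tangentBundle_mk (n := n)).contMDiffOn fun p hp => hp).congr
    fun p hp => tangentPoint_eq hp p.2

theorem contMDiffOn_tangentPoint_const [IsManifold (𝓡 n) ∞ M]
    (hφ : φ ∈ IsManifold.maximalAtlas (𝓡 n) ∞ M) (y : Model n) :
    ContMDiffOn (𝓡 n) (𝓡 n).tangent ∞ (fun x : Model n => tangentPoint φ x y) φ.target :=
  (contMDiffOn_tangentPoint hφ).comp
    ((contDiff_id.prodMk contDiff_const).contMDiff.contMDiffOn) fun _ hx => hx

theorem tangentPoint_smul (φ : OpenPartialHomeomorph M (Model n)) (x y : Model n) (c : ℝ) :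
    tangentPoint φ x (c • y) = ⟨(tangentPoint φ x y).1, c • (tangentPoint φ x y).2⟩ := by
  unfold tangentPoint
  congr 1
  exact map_smul (mfderiv (𝓡 n) (𝓡 n) φ.symm x) c y

theorem sum_smul_stdVec (y : Model n) : y = ∑ i, y i • stdVec i := by
  ext j
  simp [stdVec, Finset.sum_apply, Pi.single_apply]

theorem apply_eq_sum_stdVec {E : Type*} [AddCommGroup E] [Module ℝ E] [TopologicalSpace E]
    (B : E →L[ℝ] ℝ) (T : Model n →L[ℝ] E) (y : Model n) :
    B (T y) = ∑ i, B (T (stdVec i)) * y i := by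
  conv_lhs => rw [sum_smul_stdVec y]
  simp [mul_comm]

theorem apply_apply_eq_sum_stdVec {E : Type*} [AddCommGroup E] [Module ℝ E] [TopologicalSpace E]
    (B : E →L[ℝ] E →L[ℝ] ℝ) (T : Model n →L[ℝ] E) (y : Model n) :
    B (T y) (T y) = ∑ i, ∑ j, B (T (stdVec i)) (T (stdVec j)) * y i * y j := by
  conv_lhs => rw [sum_smul_stdVec y]
  simp only [map_sum, map_smul, sum_apply, smul_apply, smul_eq_mul, Finset.mul_sum]
  rw [Finset.sum_comm]
  exact Finset.sum_congr rfl fun i _ => Finset.sum_congr rfl fun j _ => by ring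

theorem contDiffOn_riemCoord [IsManifold (𝓡 n) ∞ M]
    (hφ : φ ∈ IsManifold.maximalAtlas (𝓡 n) ∞ M) (g : RiemMetric n M)
    (i j : Fin n) : ContDiffOn ℝ ∞ (fun x => riemCoord φ g x i j) φ.target := by
  rw [← contMDiffOn_iff_contDiffOn]
  intro x hx
  have hv := contMDiffOn_tangentPoint_const hφ (stdVec i) x hx
  have hw := contMDiffOn_tangentPoint_const hφ (stdVec j) x hx
  have hb := contMDiffOn_symm_of_mem_maximalAtlas hφ x hx
  -- The scalar is regarded as a section of the trivial line bundle along `φ.symm`, so that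
  -- smoothness of bundle pairings applies; its fibre component is read off at the end.
  have : ContMDiffWithinAt (𝓡 n) ((𝓡 n).prod 𝓘(ℝ)) ∞
      (fun m => Bundle.TotalSpace.mk' ℝ (E := Bundle.Trivial M ℝ) (φ.symm m)
        (g.inner (φ.symm m) (tangentPoint φ m (stdVec i)).2 (tangentPoint φ m (stdVec j)).2))
      φ.target x := by
    apply ContMDiffWithinAt.clm_bundle_apply₂ (F₁ := Model n) (F₂ := Model n)
    · exact ContMDiffAt.comp_contMDiffWithinAt x g.contMDiff.contMDiffAt hb
    · exact hv
    · exact hw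
  rw [Bundle.contMDiffWithinAt_totalSpace] at this
  exact this.2

theorem contDiffOn_oneFormCoord [IsManifold (𝓡 n) ∞ M]
    (hφ : φ ∈ IsManifold.maximalAtlas (𝓡 n) ∞ M)
    {b : CovectorField n M} (hb : IsSmoothOneForm b) (i : Fin n) :
    ContDiffOn ℝ ∞ (oneFormCoord φ b i) φ.target := by
  rw [← contMDiffOn_iff_contDiffOn]
  intro x hx
  have hv := contMDiffOn_tangentPoint_const hφ (stdVec i) x hx
  have hs := contMDiffOn_symm_of_mem_maximalAtlas hφ x hx
  have : ContMDiffWithinAt (𝓡 n) ((𝓡 n).prod 𝓘(ℝ)) ∞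
      (fun m => Bundle.TotalSpace.mk' ℝ (E := Bundle.Trivial M ℝ) (φ.symm m)
        (b (φ.symm m) (tangentPoint φ m (stdVec i)).2)) φ.target x := by
    apply ContMDiffWithinAt.clm_bundle_apply (F₁ := Model n)
    · exact ContMDiffAt.comp_contMDiffWithinAt x hb.contMDiffAt hs
    · exact hv
  rw [Bundle.contMDiffWithinAt_totalSpace] at this
  exact this.2

theorem inner_tangentPoint [IsManifold (𝓡 n) ∞ M] (g : RiemMetric n M) (x y : Model n) :
    g.inner (φ.symm x) (tangentPoint φ x y).2 (tangentPoint φ x y).2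
      = ∑ i, ∑ j, riemCoord φ g x i j * y i * y j :=
  apply_apply_eq_sum_stdVec (g.inner (φ.symm x)) (mfderiv (𝓡 n) (𝓡 n) φ.symm x) y

theorem oneFormFun_tangentPoint (b : CovectorField n M) (x y : Model n) :
    oneFormFun b (tangentPoint φ x y) = ∑ i, oneFormCoord φ b i x * y i :=
  apply_eq_sum_stdVec (b (φ.symm x)) (mfderiv (𝓡 n) (𝓡 n) φ.symm x) y

theorem riemCoord_symm [IsManifold (𝓡 n) ∞ M] (g : RiemMetric n M) (x : Model n) (i j : Fin n) :
    riemCoord φ g x i j = riemCoord φ g x j i :=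
  g.symm _ _ _

/-- Since `φ ∘ φ.symm` is the identity near `x`, the differential of `φ` is a left inverse of that
of `φ.symm`. -/
theorem tangentPoint_injective (hφ : φ ∈ IsManifold.maximalAtlas (𝓡 n) ∞ M) {x : Model n}
    (hx : x ∈ φ.target) {y : Model n} (hy : (tangentPoint φ x y).2 = 0) : y = 0 := by
  have h1 : MDifferentiableAt (𝓡 n) (𝓡 n) φ.symm x :=
    (contMDiffAt_symm_of_mem_maximalAtlas hφ hx).mdifferentiableAt (by simp)
  have h2 : MDifferentiableAt (𝓡 n) (𝓡 n) φ (φ.symm x) :=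
    (contMDiffAt_of_mem_maximalAtlas hφ (φ.map_target hx)).mdifferentiableAt (by simp)
  have h3 := mfderiv_comp x h2 h1
  have h4 : mfderiv (𝓡 n) (𝓡 n) (φ ∘ φ.symm) x = ContinuousLinearMap.id ℝ _ := by
    rw [← mfderiv_id]
    refine Filter.EventuallyEq.mfderiv_eq ?_
    filter_upwards [φ.open_target.mem_nhds hx] with z hz using φ.right_inv hz
  have h5 := congrArg (fun T => T y) (h4.symm.trans h3)
  have h6 : mfderiv (𝓡 n) (𝓡 n) φ.symm x y = 0 := hy
  refine h5.trans ?_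
  change mfderiv (𝓡 n) (𝓡 n) φ (φ.symm x) (mfderiv (𝓡 n) (𝓡 n) φ.symm x y) = 0
  rw [h6, map_zero]

/-- A kernel vector of the matrix would represent a tangent vector of zero length, hence zero by
positivity of `g`, and so vanish by `tangentPoint_injective`. -/
theorem det_riemCoord_ne_zero [IsManifold (𝓡 n) ∞ M]
    (hφ : φ ∈ IsManifold.maximalAtlas (𝓡 n) ∞ M) (g : RiemMetric n M)
    {x : Model n} (hx : x ∈ φ.target) : (riemCoord φ g x).det ≠ 0 := by
  intro h
  obtain ⟨v, hv, hv0⟩ := Matrix.exists_mulVec_eq_zero_iff.mpr h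
  refine hv ?_
  have hz : ∑ i, ∑ j, riemCoord φ g x i j * v i * v j = 0 := by
    refine Finset.sum_eq_zero fun i _ => ?_
    have := congrFun hv0 i
    simp only [Matrix.mulVec, dotProduct, Pi.zero_apply] at this
    calc ∑ j, riemCoord φ g x i j * v i * v j = v i * ∑ j, riemCoord φ g x i j * v j := by
          rw [Finset.mul_sum]; exact Finset.sum_congr rfl fun j _ => by ring
      _ = 0 := by rw [this, mul_zero]
  have h0 : (tangentPoint φ x (WithLp.toLp 2 v)).2 = 0 := by
    by_contra hne
    have := g.pos _ _ hne
    have h' := inner_tangentPoint (φ := φ) g x (WithLp.toLp 2 v)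
    exact this.ne' (h'.trans hz)
  have := tangentPoint_injective hφ hx h0
  ext i
  exact congrArg (fun w : Model n => w i) this

theorem hasFDerivAt_homothetic (hφ : φ ∈ IsManifold.maximalAtlas (𝓡 n) ∞ M) {σ : M → ℝ}
    (hσ : IsHomothetic (n := n) σ) {x : Model n} (hx : x ∈ φ.target) :
    HasFDerivAt (fun z => σ (φ.symm z)) (0 : Model n →L[ℝ] ℝ) x := by
  have h1 : MDifferentiableAt (𝓡 n) (𝓡 n) φ.symm x :=
    (contMDiffAt_symm_of_mem_maximalAtlas hφ hx).mdifferentiableAt (by simp)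
  have h2 : MDifferentiableAt (𝓡 n) 𝓘(ℝ) σ (φ.symm x) :=
    hσ.1.contMDiffAt.mdifferentiableAt (by simp)
  have h3 := h2.hasMFDerivAt.comp x h1.hasMFDerivAt
  rw [hσ.2, hasMFDerivAt_iff_hasFDerivAt] at h3
  exact h3.congr_fderiv (ContinuousLinearMap.zero_comp _)

end Chart

/-! ### Transfer to the manifold. -/

section ChangeOnManifold

variable {n : ℕ} {M : Type*} [TopologicalSpace M] [ChartedSpace (Model n) M]
  [IsManifold (𝓡 n) ∞ M] {φ : OpenPartialHomeomorph M (Model n)}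

/-- The set of coordinates `(x, y)` of the elements of `A` in the chart `φ`. -/
def coordDomain (φ : OpenPartialHomeomorph M (Model n)) (A : Set (TangentBundle (𝓡 n) M)) :
    Set (Model n × Model n) :=
  Prod.fst ⁻¹' φ.target ∩ (fun p => tangentPoint φ p.1 p.2) ⁻¹' A

theorem isOpen_coordDomain (hφ : φ ∈ IsManifold.maximalAtlas (𝓡 n) ∞ M)
    {A : Set (TangentBundle (𝓡 n) M)} (hA : IsOpen A) : IsOpen (coordDomain φ A) :=
  (contMDiffOn_tangentPoint hφ).continuousOn.isOpen_inter_preimage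
    (φ.open_target.preimage continuous_fst) hA

theorem contDiffOn_energy_localRep (hφ : φ ∈ IsManifold.maximalAtlas (𝓡 n) ∞ M)
    {A : Set (TangentBundle (𝓡 n) M)} {F : TangentBundle (𝓡 n) M → ℝ}
    (hF : ContMDiffOn (𝓡 n).tangent 𝓘(ℝ) ∞ F A) :
    ContDiffOn ℝ ∞ (energy (localRep φ F)) (coordDomain φ A) := by
  have h := hF.comp ((contMDiffOn_tangentPoint hφ).mono Set.inter_subset_left)
    (fun p hp => hp.2 : coordDomain φ A ⊆ _)
  exact (contMDiffOn_iff_contDiffOn.mp h).pow 2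

theorem localRep_betaConformalChange (f : ℝ × ℝ → ℝ) (σ : M → ℝ) (g : RiemMetric n M)
    (b : CovectorField n M) (x y : Model n) :
    localRep φ (betaConformalChange f σ (riemannianNorm g) b) x y
      = coordChange f (fun z => σ (φ.symm z)) (riemCoord φ g) (oneFormCoord φ b) (x, y) := by
  simp only [localRep, betaConformalChange, changeArg, coordChange, oneFormFun_tangentPoint,
    riemannianNorm, quadForm, linForm]
  rw [← inner_tangentPoint]
  rfl

/-- The Berwald connection of the change is the Levi-Civita connection of `g`. -/
theorem berwaldCoeff_betaConformalChange (g : RiemMetric n M) {b : CovectorField n M}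
    (hb : IsSmoothOneForm b) (hpar : IsRiemannParallel g b) {σ : M → ℝ}
    (hσ : IsHomothetic (n := n) σ) {U : Set (ℝ × ℝ)} {f : ℝ × ℝ → ℝ}
    (hf : IsHomogeneousChange U f) {A : Set (TangentBundle (𝓡 n) M)}
    (hAU : ∀ v ∈ A, changeArg σ (riemannianNorm g) b v ∈ U)
    (hF : IsFinslerStructureOn A (betaConformalChange f σ (riemannianNorm g) b))
    (hφ : φ ∈ IsManifold.maximalAtlas (𝓡 n) ∞ M) {x y : Model n} (hx : x ∈ φ.target)
    (hy : tangentPoint φ x y ∈ A) (i j k : Fin n) :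
    berwaldCoeff (localRep φ (betaConformalChange f σ (riemannianNorm g) b)) x y i j k
      = christoffel (riemCoord φ g) x i j k := by
  have hW := isOpen_coordDomain hφ hF.isOpen
  refine berwaldCoeff_eq_of_horizontal (W := coordDomain φ A) hW
    (contDiffOn_energy_localRep hφ hF.smooth) ?_ (fun p hp => hF.nondegenerate φ hφ _ hp.1 _ hp.2)
    (fun i j k => christoffel_symm (riemCoord_symm g) x i j k) ?_ ⟨hx, hy⟩ i j k
  · intro p hp c hc
    simp only [localRep, tangentPoint_smul]
    exact hF.homogeneous _ hp.2 c hc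
  · intro v hv k
    -- `A` avoids the zero section, so the quadratic form is nonzero and its square root is
    -- differentiable there.
    have hne := hF.ne_zero _ hv.2
    have hq : quadForm (riemCoord φ g) (x, v) ≠ 0 := by
      have h := g.pos _ _ hne
      exact ((inner_tangentPoint (φ := φ) g x v).symm.trans_ne h.ne')
    have hU := hAU _ hv.2
    have hΦ : changeArg σ (riemannianNorm g) b (tangentPoint φ x v)
        = (Real.exp (σ (φ.symm x)) * Real.sqrt (quadForm (riemCoord φ g) (x, v)),
          linForm (oneFormCoord φ b) (x, v)) := by
      simp only [changeArg, oneFormFun_tangentPoint, riemannianNorm, quadForm, linForm]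
      rw [← inner_tangentPoint]
      rfl
    simp only [hΦ] at hU
    refine energy_horizontal (p := (x, v)) (b := oneFormCoord φ b)
      (Filter.Eventually.of_forall fun p => localRep_betaConformalChange f σ g b p.1 p.2)
      (differentiableAt_of_contDiffOn hf.isOpen hf.smooth hU)
      (hasFDerivAt_homothetic hφ hσ hx) (riemCoord_symm g)
      (fun i j => differentiableAt_of_contDiffOn φ.open_target (contDiffOn_riemCoord hφ g i j) hx)
      (det_riemCoord_ne_zero hφ g hx) hq
      (fun i => differentiableAt_of_contDiffOn φ.open_target (contDiffOn_oneFormCoord hφ hb i) hx)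
      k fun i => ?_
    -- The parallelism condition has the lower indices in the order `i, k`, the horizontal lift in
    -- the order `k, i`; the torsion-free symmetry reconciles them.
    have h := hpar φ hφ x hx i k
    rw [← h]
    congr 1
    exact Finset.sum_congr rfl fun r _ => by rw [christoffel_symm (riemCoord_symm g) x r k i]

end ChangeOnManifold

end Finsler

end

theorem mainTheorem8 {n : ℕ} {M : Type*} [TopologicalSpace M]
    [ChartedSpace (EuclideanSpace ℝ (Fin n)) M] [IsManifold (𝓡 n) ∞ M]
    (g : Finsler.RiemMetric n M)
    (b : Finsler.CovectorField n M) (hb : Finsler.IsSmoothOneForm b)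
    (hpar : Finsler.IsRiemannParallel g b)
    (σ : M → ℝ) (hσ : Finsler.IsHomothetic (n := n) σ)
    (U : Set (ℝ × ℝ)) (f : ℝ × ℝ → ℝ) (hf : Finsler.IsHomogeneousChange U f)
    (A : Set (TangentBundle (𝓡 n) M))
    (hAU : ∀ v ∈ A, Finsler.changeArg σ (Finsler.riemannianNorm g) b v ∈ U)
    (hF : Finsler.IsFinslerStructureOn A
      (Finsler.betaConformalChange f σ (Finsler.riemannianNorm g) b)) :
    Finsler.IsBerwaldSpaceOn A
      (Finsler.betaConformalChange f σ (Finsler.riemannianNorm g) b) :=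
  ⟨hF, fun φ hφ => ⟨Finsler.christoffel (Finsler.riemCoord φ g), fun _ hx _ hy i j k =>
    Finsler.berwaldCoeff_betaConformalChange g hb hpar hσ hf hAU hF hφ hx hy i j k⟩⟩
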